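/- Let $U$ be a universal prefix-free machine, that is, a Turing machine computing a partial function from $2^{<\omega}$ to $2^{<\omega}$ whose domain is prefix-free and such that for every partial computable function $M$ from $2^{<\omega}$ to $2^{<\omega}$ with prefix-free domain there is a constant $c$ such that whenever $M(\sigma){\downarrow}=\tau$ there is $\sigma'$ with $|\sigma'|\le|\sigma|+c$ and $U(\sigma'){\downarrow}=\tau$. For $\tau\in2^{<\omega}$ let $K(\tau)=\min\{|\sigma| : U(\sigma){\downarrow}=\tau\}$, and for a computable time bound $t$ (a total, non-decreasing computable function $t:\omega\to\omega$) let $K^t(\tau)=\min\{|\sigma| : U(\sigma){\downarrow}=\tau \text{ in at most } t(|\tau|) \text{ steps}\}$, where $\min\emptyset=\infty$. A sequence $X\in2^\omega$ is *strongly deep* if $K^t(X{\upharpoonright}n)-K(X{\upharpoonright}n)\to\infty$ as $n\to\infty$ for every computable time bound $t$; a set $C\subseteq\omega$ is strongly deep if its characteristic sequence is. Let $(\varphi_e)_{e\in\omega}$ be a standard enumeration of the partial computable functions from $\omega$ to $\omega$; $C\subseteq\omega$ is an *index set* if $\varphi_e=\varphi_i$ implies $e\in C\Leftrightarrow i\in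 C$. **Theorem.** If an index set $C\subseteq\omega$ is not strongly deep, then $C=\emptyset$ or $C=\omega$. Equivalently, every index set $C$ with $C\neq\emptyset$ and $C\neq\omega$ is strongly deep. -/

import Mathlib

namespace StrongDepth

/-- Single-tape Turing machines with finitely many states (state `0` is initial) and with the tape
alphabet `{blank, 0, 1}`; the blank is `none`. In each step the machine reads the scanned cell and
either halts, or changes its state and moves the head one cell or overwrites the scanned cell. -/
abbrev TuringMachine (k : ℕ) : Type :=
  Turing.TM0.Machine (Option Bool) (Fin (k + 1))

/-- The initial configuration on input `σ`: the input on an otherwise blank two-way infinite tape,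
with the head on its first bit. -/
def initCfg (k : ℕ) (σ : List Bool) : Turing.TM0.Cfg (Option Bool) (Fin (k + 1)) :=
  Turing.TM0.init (σ.map some)

/-- The configuration after exactly `s` steps on input `σ`; it is `none` if the machine has halted
after fewer than `s` steps. -/
def cfgAfter {k : ℕ} (U : TuringMachine k) (σ : List Bool) (s : ℕ) :
    Option (Turing.TM0.Cfg (Option Bool) (Fin (k + 1))) :=
  (fun c => c.bind (Turing.TM0.step U))^[s] (some (initCfg k σ))

/-- `U(σ)↓ = τ` after exactly `s` steps: the machine is then in a halting configuration, and the
tape from the head rightwards consists of the bits of `τ` followed by blanks only. -/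
def HaltsWith {k : ℕ} (U : TuringMachine k) (σ τ : List Bool) (s : ℕ) : Prop :=
  ∃ c, cfgAfter U σ s = some c ∧ Turing.TM0.step U c = none ∧
    c.Tape.right₀ = Turing.ListBlank.mk (τ.map some)

/-- `U(σ)↓ = τ`. -/
def Computes {k : ℕ} (U : TuringMachine k) (σ τ : List Bool) : Prop :=
  ∃ s, HaltsWith U σ τ s

/-- `U(σ)↓ = τ` in at most `s` steps. -/
def ComputesWithin {k : ℕ} (U : TuringMachine k) (σ τ : List Bool) (s : ℕ) : Prop :=
  ∃ r ≤ s, HaltsWith U σ τ r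

/-- No string in `D` is a proper prefix of another string in `D`. -/
def PrefixFree (D : Set (List Bool)) : Prop :=
  ∀ σ ∈ D, ∀ ρ ∈ D, σ <+: ρ → σ = ρ

/-- `U` is a universal prefix-free machine: its domain is prefix-free, and it simulates every
prefix-free machine `M` (a partial computable function on strings with prefix-free domain) with
programs that are longer by at most a constant. This includes the machines that are universal by
adjunction, i.e. for every `M` there is a string `ρ` with `U(ρσ) = M(σ)` for all `σ`. -/
def IsUniversalPrefixFree {k : ℕ} (U : TuringMachine k) : Prop :=
  PrefixFree {σ | ∃ τ, Computes U σ τ} ∧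
  ∀ M : List Bool →. List Bool, Partrec M → PrefixFree M.Dom →
    ∃ c : ℕ, ∀ σ τ, τ ∈ M σ → ∃ σ', σ'.length ≤ σ.length + c ∧ Computes U σ' τ

/-- `K(τ) = min {|σ| : U(σ)↓ = τ}` (`⊤` if there is no such `σ`). -/
noncomputable def K {k : ℕ} (U : TuringMachine k) (τ : List Bool) : ℕ∞ :=
  ⨅ (σ : List Bool) (_ : Computes U σ τ), (σ.length : ℕ∞)

/-- `K^t(τ) = min {|σ| : U(σ)↓ = τ in ≤ t(|τ|) steps}` (`⊤` if there is no such `σ`). -/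
noncomputable def timeK {k : ℕ} (U : TuringMachine k) (t : ℕ → ℕ) (τ : List Bool) : ℕ∞ :=
  ⨅ (σ : List Bool) (_ : ComputesWithin U σ τ (t τ.length)), (σ.length : ℕ∞)

/-- The initial segment `X ↾ n` of length `n`. -/
def initSeg (X : ℕ → Bool) (n : ℕ) : List Bool :=
  (List.range n).map X

/-- `X` is strongly deep (with respect to `U`): `K^t(X ↾ n) - K(X ↾ n) → ∞` for every computable
time bound `t`, a time bound being a total non-decreasing function. The convergence is spelled out
without subtraction. -/
def StronglyDeep {k : ℕ} (U : TuringMachine k) (X : ℕ → Bool) : Prop :=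
  ∀ t : ℕ → ℕ, Computable t → Monotone t →
    ∀ c : ℕ, ∀ᶠ n in Filter.atTop, K U (initSeg X n) + c ≤ timeK U t (initSeg X n)

open Classical in
/-- The characteristic sequence of a set of natural numbers. -/
noncomputable def charSeq (C : Set ℕ) : ℕ → Bool :=
  fun n => decide (n ∈ C)

/-- The standard enumeration `(φ_e)` of the partial computable functions. -/
def phi (e : ℕ) : ℕ →. ℕ :=
  (Denumerable.ofNat Nat.Partrec.Code e).eval

/-- `C` is an index set: membership of `e` depends only on the function `φ_e`. -/
def IsIndexSet (C : Set ℕ) : Prop :=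
  ∀ e i : ℕ, phi e = phi i → (e ∈ C ↔ i ∈ C)

end StrongDepth

/-!
Every nontrivial index set `C` is strongly deep. Fix a time bound `t`, indices `a ∈ C` and `b ∉ C`,
and a constant `r`. The idea is to build, with the recursion theorem, infinitely many indices whose
membership in `C` can be prescribed, and to prescribe it so that fast programs for initial segments
of `C` are rare, hence compressible.

By the recursion theorem (`exists_controlled_code`) there is a code `c` whose indices
`controlIndex c j i` compute `φ_a` or `φ_b` according to bits `controlBit` that are themselves
computed from `c`; as `C` is an index set, these bits are the values of the characteristic sequence
of `C` at the controlled indices. The lengths are divided into consecutive blocks such that the `j`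
indices `controlIndex c j i`, `i < j`, are smaller than every length in block `j`. Consider the
finitely many relevant programs that produce a string with a length in block `j` within the time
allowed by `t`. The control bits are chosen one after another, each time taking the value shared by
the lighter half, in the sense of the weight `2 ^ (-|σ|)`, of the programs that remain. After `j`
choices the remaining weight is at most `2 ^ (-j)` times the original one
(`two_pow_mul_sum_survivors_le`), and a fast program for an initial segment of `C` always remains
(`mem_survivors`).

Each program has only one output, so by Kraft's inequality the original weights of all blocks
together are at most `1`. Hence the requests for programs that are `j` bits shorter than the
survivors of block `j` have total weight at most `1` as well (`PrefixFree.sum_blockRequest_le_one`),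
and the Kraft–Chaitin theorem (`IsUniversalPrefixFree.exists_program_of_requests`) shows that
`K(C ↾ n) ≤ K^t(C ↾ n) - j + O(1)` for `n` in block `j`. Programs that are too long to be relevant
are dealt with by a crude computable upper bound for `K`
(`IsUniversalPrefixFree.exists_program_le_encode`).
-/

namespace StrongDepth

/-! ### Simulating a machine for a bounded number of steps -/

/-- A configuration `(q, L, R)` written with lists: `R` is the tape from the head rightwards, and
`L` is the part to the left of the head, read from right to left. -/
abbrev ListCfg (k : ℕ) : Type :=
  Fin (k + 1) × List (Option Bool) × List (Option Bool)

/-- The configuration represented by a list configuration. -/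
def ListCfg.toCfg {k : ℕ} (s : ListCfg k) : Turing.TM0.Cfg (Option Bool) (Fin (k + 1)) :=
  ⟨s.1, Turing.Tape.mk₂ s.2.1 s.2.2⟩

/-- The transition table of `U`, with moves encoded by a bit (`true` is left). -/
def action {k : ℕ} (U : TuringMachine k) (p : Fin (k + 1) × Option Bool) :
    Option (Fin (k + 1) × (Bool ⊕ Option Bool)) :=
  (U p.1 p.2).map fun x => (x.1, match x.2 with
    | .move .left => .inl true
    | .move .right => .inl false
    | .write a => .inr a)

/-- The effect of a move (`true` is left) or of a write on the two halves of the tape. -/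
def applyAction (L R : List (Option Bool)) (x : Bool ⊕ Option Bool) :
    List (Option Bool) × List (Option Bool) :=
  Sum.casesOn x (fun b => cond b (L.tail, L.headI :: R) (R.headI :: L, R.tail))
    (fun a => (L, a :: R.tail))

/-- One step of `U` on list configurations. -/
def listStep {k : ℕ} (U : TuringMachine k) (s : ListCfg k) : Option (ListCfg k) :=
  (action U (s.1, s.2.2.headI)).map fun x => (x.1, applyAction s.2.1 s.2.2 x.2)

theorem step_toCfg {k : ℕ} (U : TuringMachine k) (s : ListCfg k) :
    Turing.TM0.step U s.toCfg = (listStep U s).map ListCfg.toCfg := by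
  obtain ⟨q, L, R⟩ := s
  have hhead : (ListCfg.toCfg (q, L, R)).Tape.head = R.headI := by
    simp [ListCfg.toCfg, Turing.Tape.mk₂, Turing.Tape.mk'_head, Turing.ListBlank.head_mk]
  simp only [Turing.TM0.step, hhead, listStep, action, Option.map_map]
  have : (ListCfg.toCfg (q, L, R)).q = q := rfl
  rw [this]
  congr 1
  funext ⟨q', st⟩
  rcases st with (_ | _) | a
  · simp [ListCfg.toCfg, applyAction, Turing.Tape.mk₂, Turing.Tape.move_left_mk',
      Turing.ListBlank.cons_mk]
  · simp [ListCfg.toCfg, applyAction, Turing.Tape.mk₂, Turing.Tape.move_right_mk',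
      Turing.ListBlank.cons_mk]
  · simp [ListCfg.toCfg, applyAction, Turing.Tape.mk₂]

theorem primrec_applyAction : Primrec fun p : (List (Option Bool) × List (Option Bool)) ×
    (Bool ⊕ Option Bool) => applyAction p.1.1 p.1.2 p.2 := by
  refine Primrec.sumCasesOn Primrec.snd ?_ ?_
  · have hL := Primrec.fst.comp (Primrec.fst.comp (Primrec.fst
      (α := (List (Option Bool) × List (Option Bool)) × (Bool ⊕ Option Bool)) (β := Bool)))
    have hR := Primrec.snd.comp (Primrec.fst.comp (Primrec.fst
      (α := (List (Option Bool) × List (Option Bool)) × (Bool ⊕ Option Bool)) (β := Bool)))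
    exact Primrec.cond Primrec.snd
      ((Primrec.list_tail.comp hL).pair
        (Primrec.list_cons.comp (Primrec.list_headI.comp hL) hR))
      ((Primrec.list_cons.comp (Primrec.list_headI.comp hR) hL).pair
        (Primrec.list_tail.comp hR))
  · exact (Primrec.fst.comp (Primrec.fst.comp Primrec.fst)).pair (Primrec.list_cons.comp Primrec.snd
      (Primrec.list_tail.comp (Primrec.snd.comp (Primrec.fst.comp Primrec.fst))))

theorem primrec_listStep {k : ℕ} (U : TuringMachine k) : Primrec (listStep U) :=
  Primrec.option_map ((Primrec.dom_finite (action U)).comp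
    (Primrec.fst.pair (Primrec.list_headI.comp (Primrec.snd.comp Primrec.snd))))
    ((Primrec.fst.comp Primrec.snd).pair (primrec_applyAction.comp
      ((Primrec.snd.comp Primrec.fst).pair (Primrec.snd.comp Primrec.snd))))

/-- Reads a tape segment as a string followed by blanks only, if it has this form. -/
def readBits (l : List (Option Bool)) : Option (List Bool) :=
  l.foldr (fun a acc => acc.bind fun r => Option.casesOn a (cond r.isEmpty (some []) none)
    fun b => some (b :: r)) (some [])

theorem primrec_readBits : Primrec readBits := by
  have hstep : Primrec fun q : List (Option Bool) × (Option Bool × Option (List Bool)) =>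
      q.2.2.bind fun r => (Option.casesOn q.2.1 (cond r.isEmpty (some []) none)
        fun b => some (b :: r) : Option (List Bool)) := by
    refine Primrec.option_bind (Primrec.snd.comp Primrec.snd)
      (Primrec.option_casesOn (Primrec.fst.comp (Primrec.snd.comp Primrec.fst)) ?_ ?_)
    · refine Primrec.cond ?_ (Primrec.const _) (Primrec.const _)
      exact (Primrec.beq.comp (Primrec.list_length.comp Primrec.snd) (Primrec.const 0)).of_eq
        fun q => by cases q.2 <;> simp
    · exact Primrec.option_some.comp
        (Primrec.list_cons.comp Primrec.snd (Primrec.snd.comp Primrec.fst))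
  exact Primrec.list_foldr Primrec.id (Primrec.const _) hstep.to₂

theorem mk_cons_eq_mk_cons {Γ : Type*} [Inhabited Γ] (a b : Γ) (l m : List Γ) :
    Turing.ListBlank.mk (a :: l) = Turing.ListBlank.mk (b :: m) ↔
      a = b ∧ Turing.ListBlank.mk l = Turing.ListBlank.mk m := by
  constructor
  · intro h
    exact ⟨by simpa [Turing.ListBlank.head_mk] using congrArg Turing.ListBlank.head h,
      by simpa [Turing.ListBlank.tail_mk] using congrArg Turing.ListBlank.tail h⟩
  · rintro ⟨rfl, h⟩
    rw [← Turing.ListBlank.cons_mk, h, Turing.ListBlank.cons_mk]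

theorem mk_nil_eq {Γ : Type*} [Inhabited Γ] :
    Turing.ListBlank.mk ([] : List Γ) = Turing.ListBlank.mk [default] :=
  Quotient.sound (Or.inl ⟨1, rfl⟩)

theorem readBits_eq_some (l : List (Option Bool)) (τ : List Bool) :
    readBits l = some τ ↔ Turing.ListBlank.mk l = Turing.ListBlank.mk (τ.map some) := by
  induction l generalizing τ with
  | nil =>
    cases τ with
    | nil => simp [readBits]
    | cons b τ =>
      rw [mk_nil_eq, List.map_cons, mk_cons_eq_mk_cons]
      simp [readBits, default]
  | cons a l ih =>
    have hstep : readBits (a :: l) = (readBits l).bind fun r =>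
      Option.casesOn a (cond r.isEmpty (some []) none) fun b => some (b :: r) := rfl
    rw [hstep]
    cases a with
    | none =>
      cases τ with
      | nil =>
        rw [List.map_nil, mk_nil_eq, mk_cons_eq_mk_cons]
        have := ih []
        rw [List.map_nil] at this
        rw [← this]
        cases h : readBits l with
        | none => simp
        | some r => cases r <;> simp [default]
      | cons b τ =>
        rw [List.map_cons, mk_cons_eq_mk_cons]
        cases h : readBits l with
        | none => simp
        | some r => cases r <;> simp
    | some c =>
      cases τ with
      | nil =>
        rw [List.map_nil, mk_nil_eq, mk_cons_eq_mk_cons]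
        cases h : readBits l <;> simp [default]
      | cons b τ =>
        rw [List.map_cons, mk_cons_eq_mk_cons, ← ih τ]
        cases h : readBits l <;> simp

/-- The initial list configuration on input `σ`. -/
def listInit (k : ℕ) (σ : List Bool) : ListCfg k :=
  (default, [], σ.map some)

/-- The output of `U` on input `σ` if the machine halts, with a proper output, in at most `S` steps.
The simulation runs for `S` steps and stays in a halting configuration once it is reached. -/
def outputWithin {k : ℕ} (U : TuringMachine k) (σ : List Bool) (S : ℕ) : Option (List Bool) :=
  let s := (fun s => (listStep U s).getD s)^[S] (listInit k σ)
  cond (listStep U s).isSome none (readBits s.2.2)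

theorem primrec_outputWithin {k : ℕ} (U : TuringMachine k) : Primrec₂ (outputWithin U) := by
  have hrun : Primrec fun p : List Bool × ℕ =>
      (fun s => (listStep U s).getD s)^[p.2] (listInit k p.1) := by
    refine Primrec.nat_iterate Primrec.snd ?_ ?_
    · exact (Primrec.const _).pair ((Primrec.const _).pair
        (Primrec.list_map Primrec.fst (Primrec.option_some.comp Primrec.snd).to₂))
    · exact (Primrec.option_getD.comp ((primrec_listStep U).comp Primrec.snd) Primrec.snd).to₂
  exact Primrec.cond (Primrec.option_isSome.comp ((primrec_listStep U).comp hrun))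
    (Primrec.const _) (primrec_readBits.comp (Primrec.snd.comp (Primrec.snd.comp hrun)))

theorem iterate_bind_none {X : Type*} (f : X → Option X) (n : ℕ) :
    (fun c : Option X => c.bind f)^[n] none = none := by
  induction n with
  | zero => rfl
  | succ n ih => rw [Function.iterate_succ_apply]; exact ih

theorem iterate_getD_of_halted {X : Type*} {f : X → Option X} {x : X} (hx : f x = none) (n : ℕ) :
    (fun c => (f c).getD c)^[n] x = x :=
  Function.iterate_fixed (by simp [hx]) n

/-- A computation halts in `y` after at most `S` steps iff the computation that idles in halting
configurations is in `y` after exactly `S` steps. -/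
theorem exists_halts_iff {X : Type*} (f : X → Option X) (x y : X) (S : ℕ) :
    (∃ r ≤ S, (fun c : Option X => c.bind f)^[r] (some x) = some y ∧ f y = none) ↔
      (fun c => (f c).getD c)^[S] x = y ∧ f y = none := by
  induction S generalizing x with
  | zero => simp
  | succ S ih =>
    cases hx : f x with
    | none =>
      have hfix := iterate_getD_of_halted hx (S + 1)
      rw [hfix]
      constructor
      · rintro ⟨r, -, hr, hy⟩
        cases r with
        | zero => exact ⟨by simpa using hr, hy⟩
        | succ r =>
          rw [Function.iterate_succ_apply, Option.bind_some, hx, iterate_bind_none] at hr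
          simp at hr
      · rintro ⟨rfl, h⟩
        exact ⟨0, by simp, by simp, h⟩
    | some x' =>
      rw [Function.iterate_succ_apply]
      simp only [hx, Option.getD_some]
      rw [← ih x']
      constructor
      · rintro ⟨r, hr, h, hy⟩
        cases r with
        | zero =>
          obtain rfl : x = y := by simpa using h
          simp [hx] at hy
        | succ r =>
          rw [Function.iterate_succ_apply, Option.bind_some, hx] at h
          exact ⟨r, by omega, h, hy⟩
      · rintro ⟨r, hr, h, hy⟩
        refine ⟨r + 1, by omega, ?_, hy⟩
        rw [Function.iterate_succ_apply, Option.bind_some, hx]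
        exact h

theorem cfgAfter_eq {k : ℕ} (U : TuringMachine k) (σ : List Bool) (r : ℕ) :
    cfgAfter U σ r =
      ((fun c : Option (ListCfg k) => c.bind (listStep U))^[r] (some (listInit k σ))).map
        ListCfg.toCfg := by
  unfold cfgAfter
  have h0 : some (initCfg k σ) = (some (listInit k σ)).map ListCfg.toCfg := rfl
  rw [h0]
  refine ((Function.Semiconj.iterate_right (f := Option.map ListCfg.toCfg) ?_ r) _).symm
  rintro (_ | s)
  · rfl
  · simp [step_toCfg]

theorem haltsWith_iff {k : ℕ} (U : TuringMachine k) (σ τ : List Bool) (r : ℕ) :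
    HaltsWith U σ τ r ↔ ∃ s, (fun c : Option (ListCfg k) => c.bind (listStep U))^[r]
      (some (listInit k σ)) = some s ∧ listStep U s = none ∧ readBits s.2.2 = some τ := by
  have key : ∀ s : ListCfg k, s.toCfg.Tape.right₀ = Turing.ListBlank.mk s.2.2 := fun s =>
    Turing.Tape.mk'_right₀ _ _
  unfold HaltsWith
  rw [cfgAfter_eq]
  constructor
  · rintro ⟨c, hc, hh, ho⟩
    obtain ⟨s, hs, rfl⟩ := Option.map_eq_some_iff.1 hc
    refine ⟨s, hs, ?_, ?_⟩
    · simpa [step_toCfg] using hh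
    · rwa [readBits_eq_some, ← key]
  · rintro ⟨s, hs, hh, ho⟩
    refine ⟨s.toCfg, by rw [hs]; rfl, by simp [step_toCfg, hh], ?_⟩
    rwa [key, ← readBits_eq_some]

theorem outputWithin_eq_some {k : ℕ} (U : TuringMachine k) (σ τ : List Bool) (S : ℕ) :
    outputWithin U σ S = some τ ↔ ComputesWithin U σ τ S := by
  have hcomm : ComputesWithin U σ τ S ↔ ∃ s, (∃ r ≤ S,
      (fun c : Option (ListCfg k) => c.bind (listStep U))^[r] (some (listInit k σ)) = some s ∧
        listStep U s = none) ∧ readBits s.2.2 = some τ := by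
    unfold ComputesWithin
    simp only [haltsWith_iff]
    constructor
    · rintro ⟨r, hr, s, h1, h2, h3⟩
      exact ⟨s, ⟨r, hr, h1, h2⟩, h3⟩
    · rintro ⟨s, ⟨r, hr, h1, h2⟩, h3⟩
      exact ⟨r, hr, s, h1, h2, h3⟩
  rw [hcomm]
  simp only [exists_halts_iff, outputWithin]
  constructor
  · intro h
    refine ⟨_, ⟨rfl, ?_⟩, ?_⟩
    · by_contra hne
      rw [← ne_eq, Option.ne_none_iff_isSome] at hne
      simp [hne] at h
    · cases hb : (listStep U ((fun s => (listStep U s).getD s)^[S] (listInit k σ))).isSome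
      · simpa [hb] using h
      · simp [hb] at h
  · rintro ⟨s, ⟨rfl, h⟩, ho⟩
    simp [h, ho]

theorem ComputesWithin.mono {k : ℕ} {U : TuringMachine k} {σ τ : List Bool} {S S' : ℕ}
    (h : ComputesWithin U σ τ S) (hS : S ≤ S') : ComputesWithin U σ τ S' :=
  let ⟨r, hr, hh⟩ := h
  ⟨r, hr.trans hS, hh⟩

theorem ComputesWithin.computes {k : ℕ} {U : TuringMachine k} {σ τ : List Bool} {S : ℕ}
    (h : ComputesWithin U σ τ S) : Computes U σ τ :=
  let ⟨r, _, hh⟩ := h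
  ⟨r, hh⟩

theorem Computes.unique {k : ℕ} {U : TuringMachine k} {σ τ τ' : List Bool}
    (h : Computes U σ τ) (h' : Computes U σ τ') : τ = τ' := by
  obtain ⟨s, hs⟩ := h
  obtain ⟨s', hs'⟩ := h'
  have h1 := (outputWithin_eq_some U σ τ (max s s')).2 ⟨s, le_max_left _ _, hs⟩
  have h2 := (outputWithin_eq_some U σ τ' (max s s')).2 ⟨s', le_max_right _ _, hs'⟩
  exact Option.some_injective _ (h1.symm.trans h2)

/-! ### Kraft's inequality -/

theorem PrefixFree.uniquelyDecodable {D : Set (List Bool)} (hD : PrefixFree D) (hnil : [] ∉ D) :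
    InformationTheory.UniquelyDecodable D := by
  intro L₁
  induction L₁ with
  | nil =>
    rintro (_ | ⟨w, L₂⟩) - h₂ h
    · rfl
    · rw [List.flatten_nil, List.flatten_cons, eq_comm, List.append_eq_nil_iff] at h
      exact absurd (h.1 ▸ h₂ w (by simp)) hnil
  | cons v L₁ ih =>
    rintro (_ | ⟨w, L₂⟩) h₁ h₂ h
    · rw [List.flatten_nil, List.flatten_cons, List.append_eq_nil_iff] at h
      exact absurd (h.1 ▸ h₁ v (by simp)) hnil
    · rw [List.flatten_cons, List.flatten_cons] at h
      have hvw : v = w := by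
        rcases List.prefix_or_prefix_of_prefix (List.prefix_append v L₁.flatten)
          (h ▸ List.prefix_append w L₂.flatten) with hp | hp
        · exact hD v (h₁ v (by simp)) w (h₂ w (by simp)) hp
        · exact (hD w (h₂ w (by simp)) v (h₁ v (by simp)) hp).symm
      subst hvw
      rw [ih L₂ (fun u hu => h₁ u (by simp [hu])) (fun u hu => h₂ u (by simp [hu]))
        (List.append_cancel_left h)]

theorem PrefixFree.mono {D D' : Set (List Bool)} (hD : PrefixFree D) (h : D' ⊆ D) :
    PrefixFree D' :=
  fun σ hσ ρ hρ => hD σ (h hσ) ρ (h hρ)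

/-- Kraft's inequality for prefix-free sets of binary strings. -/
theorem PrefixFree.sum_le_one {F : Finset (List Bool)} (hF : PrefixFree (F : Set (List Bool))) :
    ∑ σ ∈ F, (1 / 2 : ℝ) ^ σ.length ≤ 1 := by
  by_cases hnil : [] ∈ F
  · have : F = {[]} := by
      ext σ
      rw [Finset.mem_singleton]
      exact ⟨fun hσ => (hF [] hnil σ hσ (List.nil_prefix)).symm, fun h => h ▸ hnil⟩
    simp [this]
  · simpa using InformationTheory.kraft_mcmillan_inequality
      (hF.uniquelyDecodable (by simpa using hnil))

/-! ### Machines from summable requests -/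

/-- The number with binary expansion `σ`, the most significant bit coming first. -/
def bitVal (σ : List Bool) : ℕ :=
  σ.foldl (fun a b => 2 * a + b.toNat) 0

theorem primrec_bitVal : Primrec bitVal :=
  Primrec.list_foldl Primrec.id (Primrec.const 0)
    (Primrec.nat_add.comp (Primrec.nat_mul.comp (Primrec.const 2) (Primrec.fst.comp Primrec.snd))
      ((Primrec.dom_bool Bool.toNat).comp (Primrec.snd.comp Primrec.snd))).to₂

theorem bitVal_concat (σ : List Bool) (b : Bool) :
    bitVal (σ ++ [b]) = 2 * bitVal σ + b.toNat := by
  simp [bitVal]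

theorem bitVal_append (σ ρ : List Bool) :
    ∃ v < 2 ^ ρ.length, bitVal (σ ++ ρ) = bitVal σ * 2 ^ ρ.length + v := by
  induction ρ using List.reverseRecOn with
  | nil => exact ⟨0, by simp, by simp⟩
  | append_singleton ρ b ih =>
    obtain ⟨v, hv, h⟩ := ih
    refine ⟨2 * v + b.toNat, ?_, ?_⟩
    · have := b.toNat_lt
      rw [List.length_append, List.length_singleton, pow_succ]
      omega
    · rw [← List.append_assoc, bitVal_concat, h, List.length_append, List.length_singleton]
      ring

theorem exists_bitVal_eq (n m : ℕ) (h : m < 2 ^ n) :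
    ∃ σ : List Bool, σ.length = n ∧ bitVal σ = m := by
  induction n generalizing m with
  | zero => exact ⟨[], rfl, by simp at h; simp [bitVal, h]⟩
  | succ n ih =>
    obtain ⟨σ, hσ, hv⟩ := ih (m / 2) (by rw [pow_succ] at h; omega)
    refine ⟨σ ++ [decide (m % 2 = 1)], by simp [hσ], ?_⟩
    rw [bitVal_concat, hv]
    rcases Nat.mod_two_eq_zero_or_one m with h' | h' <;> simp [h'] <;> omega

theorem primrec_two_pow : Primrec fun n : ℕ => 2 ^ n :=
  (Primrec.nat_rec₁ 1 (Primrec.nat_mul.comp (Primrec.const 2) Primrec.snd).to₂).of_eq fun n => by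
    induction n with
    | zero => rfl
    | succ n ih => rw [pow_succ, mul_comm, ← ih]

/-- The weight `2 ^ (-ℓ)` of a request `(ℓ, τ)` for a program of length `ℓ` with output `τ`. -/
noncomputable def requestWeight (x : Option (ℕ × List Bool)) : ℝ :=
  x.elim 0 fun y => (1 / 2) ^ y.1

theorem requestWeight_nonneg (x : Option (ℕ × List Bool)) : 0 ≤ requestWeight x := by
  cases x
  · exact le_rfl
  · exact pow_nonneg (by norm_num) _

/-- A pair `(a, b)` such that `a / 2 ^ b` is the total weight of the first `n` requests. -/
def partialWeight (f : ℕ → Option (ℕ × List Bool)) (n : ℕ) : ℕ × ℕ :=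
  n.rec (0, 0) fun l s => Option.casesOn (f l) s
    fun y => (s.1 * 2 ^ y.1 + 2 ^ s.2, s.2 + y.1)

theorem partialWeight_spec (f : ℕ → Option (ℕ × List Bool)) (n : ℕ) :
    ((partialWeight f n).1 : ℝ) / 2 ^ (partialWeight f n).2 =
      ∑ l ∈ Finset.range n, requestWeight (f l) := by
  induction n with
  | zero => simp [partialWeight]
  | succ n ih =>
    rw [Finset.sum_range_succ, ← ih]
    have hstep : partialWeight f (n + 1) = Option.casesOn (f n) (partialWeight f n)
      fun y => ((partialWeight f n).1 * 2 ^ y.1 + 2 ^ (partialWeight f n).2,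
        (partialWeight f n).2 + y.1) := rfl
    rw [hstep]
    cases f n with
    | none => simp [requestWeight]
    | some y =>
      simp only [requestWeight, Option.elim_some, Nat.cast_add, Nat.cast_mul, Nat.cast_pow,
        Nat.cast_ofNat, pow_add, one_div, inv_pow]
      field_simp

theorem computable_partialWeight {f : ℕ → Option (ℕ × List Bool)} (hf : Computable f) :
    Computable (partialWeight f) := by
  have hs : Primrec fun q : (ℕ × ℕ × ℕ × ℕ) × ℕ × List Bool => q.1.2.2 :=
    Primrec.snd.comp (Primrec.snd.comp Primrec.fst)
  have hy : Primrec fun q : (ℕ × ℕ × ℕ × ℕ) × ℕ × List Bool => q.2.1 :=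
    Primrec.fst.comp Primrec.snd
  have hnew : Primrec fun q : (ℕ × ℕ × ℕ × ℕ) × ℕ × List Bool =>
      (q.1.2.2.1 * 2 ^ q.2.1 + 2 ^ q.1.2.2.2, q.1.2.2.2 + q.2.1) :=
    (Primrec.nat_add.comp
      (Primrec.nat_mul.comp (Primrec.fst.comp hs) (primrec_two_pow.comp hy))
      (primrec_two_pow.comp (Primrec.snd.comp hs))).pair
      (Primrec.nat_add.comp (Primrec.snd.comp hs) hy)
  exact Computable.nat_rec Computable.id (Computable.const _)
    (Computable.option_casesOn (hf.comp (Computable.fst.comp Computable.snd))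
      (Computable.snd.comp Computable.snd) hnew.to_comp.to₂).to₂

/-- The codeword of a request of length `ℓ` that is preceded by requests of total weight
`s.1 / 2 ^ s.2` has `ℓ + 2` bits, and is the binary expansion of this number. With the two extra
bits, a dyadic interval of length `2 ^ (-(ℓ + 2))` fits into the interval of length `2 ^ (-ℓ)` that
begins at the total weight of the preceding requests. -/
def codeNumber (s : ℕ × ℕ) (ℓ : ℕ) : ℕ :=
  s.1 * 2 ^ (ℓ + 2) / 2 ^ s.2 + 1

theorem primrec_codeNumber : Primrec₂ codeNumber :=
  Primrec.succ.comp (Primrec.nat_div.comp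
    (Primrec.nat_mul.comp (Primrec.fst.comp Primrec.fst)
      (primrec_two_pow.comp (Primrec.nat_add.comp Primrec.snd (Primrec.const 2))))
    (primrec_two_pow.comp (Primrec.snd.comp Primrec.fst)))

/-- The dyadic interval of a codeword lies inside the interval of its request. -/
theorem codeNumber_bounds (s : ℕ × ℕ) (ℓ : ℕ) :
    (s.1 : ℝ) / 2 ^ s.2 < codeNumber s ℓ / 2 ^ (ℓ + 2) ∧
      ((codeNumber s ℓ : ℝ) + 1) / 2 ^ (ℓ + 2) < (s.1 : ℝ) / 2 ^ s.2 + (1 / 2) ^ ℓ := by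
  have hb : (0 : ℝ) < 2 ^ s.2 := by positivity
  have hl : (0 : ℝ) < 2 ^ (ℓ + 2) := by positivity
  have h1 : (s.1 * 2 ^ (ℓ + 2) : ℝ) < codeNumber s ℓ * 2 ^ s.2 := by
    have := Nat.lt_mul_div_succ (s.1 * 2 ^ (ℓ + 2)) (b := 2 ^ s.2) (by positivity)
    rw [mul_comm (2 ^ s.2)] at this
    unfold codeNumber
    exact_mod_cast this
  have h2 : ((codeNumber s ℓ : ℝ) - 1) * 2 ^ s.2 ≤ s.1 * 2 ^ (ℓ + 2) := by
    have := Nat.div_mul_le_self (s.1 * 2 ^ (ℓ + 2)) (2 ^ s.2)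
    have h : (codeNumber s ℓ : ℝ) - 1 = ((s.1 * 2 ^ (ℓ + 2) / 2 ^ s.2 : ℕ) : ℝ) := by
      simp [codeNumber]
    rw [h]
    exact_mod_cast this
  refine ⟨by rwa [div_lt_div_iff₀ hb hl], ?_⟩
  have h3 : (1 / 2 : ℝ) ^ ℓ = 4 / 2 ^ (ℓ + 2) := by
    rw [pow_add, one_div, inv_pow]; field_simp; norm_num
  have h4 : ((codeNumber s ℓ : ℝ) - 1) / 2 ^ (ℓ + 2) ≤ s.1 / 2 ^ s.2 := by
    rwa [div_le_div_iff₀ hl hb]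
  rw [h3]
  have h5 : ((codeNumber s ℓ : ℝ) + 1) / 2 ^ (ℓ + 2) =
      ((codeNumber s ℓ : ℝ) - 1) / 2 ^ (ℓ + 2) + 2 / 2 ^ (ℓ + 2) := by ring
  have h6 : (2 : ℝ) / 2 ^ (ℓ + 2) < 4 / 2 ^ (ℓ + 2) := by gcongr; norm_num
  linarith

/-- The output that request number `l` assigns to `σ`, if `σ` is its codeword. -/
def decodeRequest (f : ℕ → Option (ℕ × List Bool)) (σ : List Bool) (l : ℕ) : Option (List Bool) :=
  (f l).bind fun y => cond (σ.length == y.1 + 2 && bitVal σ == codeNumber (partialWeight f l) y.1)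
    (some y.2) none

theorem decodeRequest_eq_some {f : ℕ → Option (ℕ × List Bool)} {σ τ : List Bool} {l : ℕ} :
    decodeRequest f σ l = some τ ↔ ∃ ℓ, f l = some (ℓ, τ) ∧ σ.length = ℓ + 2 ∧
      bitVal σ = codeNumber (partialWeight f l) ℓ := by
  unfold decodeRequest
  cases f l with
  | none => simp
  | some y =>
    obtain ⟨ℓ, τ'⟩ := y
    simp [Bool.cond_eq_ite]
    tauto

theorem computable_decodeRequest {f : ℕ → Option (ℕ × List Bool)} (hf : Computable f) :
    Computable₂ (decodeRequest f) := by
  refine Computable.option_bind (hf.comp Computable.snd) ?_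
  have hσ : Computable fun q : (List Bool × ℕ) × ℕ × List Bool => q.1.1 :=
    Computable.fst.comp Computable.fst
  have hy : Computable fun q : (List Bool × ℕ) × ℕ × List Bool => q.2.1 :=
    Computable.fst.comp Computable.snd
  refine Computable.cond ?_ (Computable.option_some.comp (Computable.snd.comp Computable.snd))
    (Computable.const _)
  refine Primrec.and.to_comp.comp ?_ ?_
  · exact Primrec.beq.to_comp.comp (Primrec.list_length.to_comp.comp hσ)
      ((Primrec.nat_add.comp Primrec.id (Primrec.const 2)).to_comp.comp hy)
  · exact Primrec.beq.to_comp.comp (primrec_bitVal.to_comp.comp hσ)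
      (primrec_codeNumber.to_comp.comp
        ((computable_partialWeight hf).comp (Computable.snd.comp Computable.fst)) hy)

/-- Codewords of distinct requests are incomparable, since their dyadic intervals are disjoint. -/
theorem decodeRequest_prefix {f : ℕ → Option (ℕ × List Bool)} {σ ρ τ τ' : List Bool} {l l' : ℕ}
    (h : decodeRequest f σ l = some τ) (h' : decodeRequest f ρ l' = some τ') (hp : σ <+: ρ) :
    l = l' := by
  obtain ⟨ℓ, hl, hlen, hv⟩ := decodeRequest_eq_some.1 h
  obtain ⟨ℓ', hl', hlen', hv'⟩ := decodeRequest_eq_some.1 h'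
  obtain ⟨ξ, rfl⟩ := hp
  obtain ⟨v, hv₁, hv₂⟩ := bitVal_append σ ξ
  set S : ℕ → ℝ := fun n => ∑ l ∈ Finset.range n, requestWeight (f l) with hS
  have hmono : Monotone S := monotone_nat_of_le_succ fun n => by
    simp only [hS, Finset.sum_range_succ]
    linarith [requestWeight_nonneg (f n)]
  have hb := codeNumber_bounds (partialWeight f l) ℓ
  have hb' := codeNumber_bounds (partialWeight f l') ℓ'
  rw [partialWeight_spec, ← hv, ← hlen] at hb
  rw [partialWeight_spec, ← hv', ← hlen'] at hb'
  have hs : S (l + 1) = S l + (1 / 2) ^ ℓ := by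
    simp only [hS, Finset.sum_range_succ, hl, requestWeight, Option.elim_some]
  have hs' : S (l' + 1) = S l' + (1 / 2) ^ ℓ' := by
    simp only [hS, Finset.sum_range_succ, hl', requestWeight, Option.elim_some]
  have hlow : (bitVal σ : ℝ) / 2 ^ σ.length ≤ bitVal (σ ++ ξ) / 2 ^ (σ ++ ξ).length := by
    rw [hv₂, List.length_append, pow_add, div_le_div_iff₀ (by positivity) (by positivity)]
    push_cast
    have : (0 : ℝ) ≤ v * 2 ^ σ.length := by positivity
    nlinarith
  have hupp : (bitVal (σ ++ ξ) : ℝ) / 2 ^ (σ ++ ξ).length ≤ (bitVal σ + 1) / 2 ^ σ.length := by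
    rw [hv₂, List.length_append, pow_add, div_le_div_iff₀ (by positivity) (by positivity)]
    push_cast
    have : (v : ℝ) * 2 ^ σ.length ≤ 2 ^ ξ.length * 2 ^ σ.length := by
      gcongr
      exact_mod_cast hv₁.le
    nlinarith
  have hstep : (bitVal (σ ++ ξ) : ℝ) / 2 ^ (σ ++ ξ).length ≤
      (bitVal (σ ++ ξ) + 1) / 2 ^ (σ ++ ξ).length := by
    gcongr
    exact le_add_of_nonneg_right zero_le_one
  have h1 : l < l' + 1 := hmono.reflect_lt (by linarith [hb.1, hb'.2])
  have h2 : l' < l + 1 := hmono.reflect_lt (by linarith [hb.2, hb'.1])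
  omega

/-- The Kraft–Chaitin theorem: a computable list of requests of total weight at most `1` is served
by a universal prefix-free machine, up to an additive constant. -/
theorem IsUniversalPrefixFree.exists_program_of_nat_requests {k : ℕ} {U : TuringMachine k}
    (hU : IsUniversalPrefixFree U) {f : ℕ → Option (ℕ × List Bool)} (hf : Computable f)
    (hsum : ∀ n, ∑ l ∈ Finset.range n, requestWeight (f l) ≤ 1) :
    ∃ d : ℕ, ∀ l ℓ τ, f l = some (ℓ, τ) → ∃ σ, σ.length ≤ ℓ + d ∧ Computes U σ τ := by
  obtain ⟨d, hd⟩ := hU.2 (fun σ => Nat.rfindOpt (decodeRequest f σ))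
    (Partrec.rfindOpt (computable_decodeRequest hf)) (by
      rintro σ hσ ρ hρ hp
      obtain ⟨l, τ, h⟩ := Nat.rfindOpt_dom.1 hσ
      obtain ⟨l', τ', h'⟩ := Nat.rfindOpt_dom.1 hρ
      obtain rfl := decodeRequest_prefix h h' hp
      obtain ⟨ℓ, hl, hlen, -⟩ := decodeRequest_eq_some.1 h
      obtain ⟨ℓ', hl', hlen', -⟩ := decodeRequest_eq_some.1 h'
      rw [hl, Option.some_inj, Prod.mk.injEq] at hl'
      exact hp.eq_of_length (by omega))
  refine ⟨2 + d, fun l ℓ τ hl => ?_⟩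
  have hb := (codeNumber_bounds (partialWeight f l) ℓ).2
  rw [partialWeight_spec] at hb
  have hs := hsum (l + 1)
  rw [Finset.sum_range_succ, hl] at hs
  have hlt : codeNumber (partialWeight f l) ℓ < 2 ^ (ℓ + 2) := by
    have h1 := hb.trans_le hs
    rw [div_lt_one (by positivity)] at h1
    have h2 : (codeNumber (partialWeight f l) ℓ : ℝ) < 2 ^ (ℓ + 2) := by linarith
    exact_mod_cast h2
  obtain ⟨σ, hlen, hv⟩ := exists_bitVal_eq _ _ hlt
  have hdec := decodeRequest_eq_some.2 ⟨ℓ, hl, hlen, hv⟩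
  have hmem : τ ∈ Nat.rfindOpt (decodeRequest f σ) := by
    have hdom := Nat.rfindOpt_dom.2 ⟨l, τ, hdec⟩
    obtain ⟨l', hl'⟩ := Nat.rfindOpt_spec ⟨hdom, rfl⟩
    obtain rfl := decodeRequest_prefix hdec hl' (List.prefix_refl σ)
    rw [Option.mem_def, hdec, Option.some_inj] at hl'
    exact ⟨hdom, hl'.symm⟩
  obtain ⟨σ', hσ', hc⟩ := hd σ τ hmem
  exact ⟨σ', by omega, hc⟩

/-- The Kraft–Chaitin theorem for requests indexed by an encodable type. -/
theorem IsUniversalPrefixFree.exists_program_of_requests {α : Type*} [Primcodable α] {k : ℕ}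
    {U : TuringMachine k} (hU : IsUniversalPrefixFree U) {f : α → Option (ℕ × List Bool)}
    (hf : Computable f) (hsum : ∀ F : Finset α, ∑ p ∈ F, requestWeight (f p) ≤ 1) :
    ∃ d : ℕ, ∀ p ℓ τ, f p = some (ℓ, τ) → ∃ σ, σ.length ≤ ℓ + d ∧ Computes U σ τ := by
  obtain ⟨d, hd⟩ := hU.exists_program_of_nat_requests
    (f := fun l => (Encodable.decode₂ α l).bind f)
    (Computable.option_bind Primrec.decode₂.to_comp (hf.comp Computable.snd).to₂) fun n => by
      rw [← Finset.sum_preimage (Encodable.encode (α := α)) _ Encodable.encode_injective.injOn _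
        fun l _ hl => ?_]
      · simpa using hsum _
      · have hnone : Encodable.decode₂ α l = none := by
          by_contra hne
          exact hl (Encodable.decode₂_ne_none_iff.1 hne)
        rw [hnone]
        rfl
  exact ⟨d, fun p ℓ τ h => hd (Encodable.encode p) ℓ τ
    (by rw [Encodable.encodek₂, Option.bind_some, h])⟩

/-- A crude computable upper bound for the complexity `K`. -/
theorem IsUniversalPrefixFree.exists_program_le_encode {k : ℕ} {U : TuringMachine k}
    (hU : IsUniversalPrefixFree U) :
    ∃ d : ℕ, ∀ τ : List Bool, ∃ σ, σ.length ≤ Encodable.encode τ + d ∧ Computes U σ τ := by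
  obtain ⟨d, hd⟩ := hU.exists_program_of_nat_requests
    (f := fun l => (Encodable.decode (α := List Bool) l).map fun τ => (l + 1, τ))
    (Computable.option_map Computable.decode
      ((Computable.succ.comp Computable.fst).pair Computable.snd).to₂) fun n => by
      have h : ∀ n, ∑ l ∈ Finset.range n, (1 / 2 : ℝ) ^ (l + 1) = 1 - (1 / 2) ^ n := by
        intro n
        induction n with
        | zero => simp
        | succ n ih => rw [Finset.sum_range_succ, ih, pow_succ]; ring
      calc _ ≤ ∑ l ∈ Finset.range n, (1 / 2 : ℝ) ^ (l + 1) := by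
            refine Finset.sum_le_sum fun l _ => ?_
            cases Encodable.decode (α := List Bool) l <;> simp [requestWeight]
        _ ≤ 1 := by
            rw [h]
            linarith [show (0 : ℝ) ≤ (1 / 2) ^ n by positivity]
  refine ⟨1 + d, fun τ => ?_⟩
  obtain ⟨σ, hσ, hc⟩ := hd (Encodable.encode τ) (Encodable.encode τ + 1) τ
    (by rw [Encodable.encodek, Option.map_some])
  exact ⟨σ, by omega, hc⟩

open Nat.Partrec (Code)

/-! ### Primitive recursive list operations -/

theorem primrec_filter {α β : Type*} [Primcodable α] [Primcodable β] {f : α → List β}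
    {p : α → β → Bool} (hf : Primrec f) (hp : Primrec₂ p) :
    Primrec fun a => (f a).filter (p a) := by
  refine (Primrec.listFilterMap (g := fun a b => cond (p a b) (some b) none) hf
    (Primrec.cond hp (Primrec.option_some.comp Primrec.snd) (Primrec.const none))).of_eq fun a => ?_
  induction f a with
  | nil => rfl
  | cons b l ih => cases h : p a b <;> simp [h, ih]

theorem primrec_list_sum : Primrec (List.sum : List ℕ → ℕ) :=
  Primrec.list_foldr Primrec.id (Primrec.const 0) (Primrec.nat_add.comp
    (Primrec.fst.comp Primrec.snd) (Primrec.snd.comp Primrec.snd)).to₂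

theorem primrec_decide_mem :
    Primrec₂ fun (σ : List Bool) (R : List (List Bool)) => decide (σ ∈ R) := by
  refine (Primrec.nat_lt.decide.comp (Primrec.list_idxOf.comp Primrec.fst Primrec.snd)
    (Primrec.list_length.comp Primrec.snd) :
      Primrec fun p : List Bool × List (List Bool) => _).of_eq fun p => ?_
  simp [List.idxOf_lt_length_iff]

/-- The list of all strings of length at most `n`. -/
def stringsLE (n : ℕ) : List (List Bool) :=
  n.rec [[]] fun _ T => [] :: (T.map (List.cons true) ++ T.map (List.cons false))

theorem stringsLE_succ (n : ℕ) : stringsLE (n + 1) =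
    [] :: ((stringsLE n).map (List.cons true) ++ (stringsLE n).map (List.cons false)) := rfl

theorem mem_stringsLE {n : ℕ} {σ : List Bool} : σ ∈ stringsLE n ↔ σ.length ≤ n := by
  induction n generalizing σ with
  | zero => simp [stringsLE]
  | succ n ih =>
    rw [stringsLE_succ]
    rcases σ with _ | ⟨_ | _, σ⟩ <;> simp [ih]

theorem nodup_stringsLE (n : ℕ) : (stringsLE n).Nodup := by
  induction n with
  | zero => simp [stringsLE]
  | succ n ih =>
    rw [stringsLE_succ, List.nodup_cons, List.nodup_append]
    exact ⟨by simp, ih.map (List.cons_injective), ih.map (List.cons_injective), by simp⟩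

theorem primrec_stringsLE : Primrec stringsLE := by
  have hmap : ∀ b : Bool, Primrec fun q : ℕ × List (List Bool) => q.2.map (List.cons b) := fun b =>
    Primrec.list_map Primrec.snd (Primrec.list_cons.comp (Primrec.const b) Primrec.snd).to₂
  exact Primrec.nat_rec₁ _ (Primrec.list_cons.comp (Primrec.const [])
    (Primrec.list_append.comp (hmap true) (hmap false))).to₂

/-! ### Halving the weight of a set of programs -/

/-- The total weight of the programs in `R`, scaled by `2 ^ L` to make it a natural number. This is
meaningful if all programs in `R` have length at most `L`. -/
def scaledWeight (L : ℕ) (R : List (List Bool)) : ℕ :=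
  (R.map fun σ => 2 ^ (L - σ.length)).sum

theorem primrec_scaledWeight : Primrec₂ scaledWeight :=
  primrec_list_sum.comp (Primrec.list_map Primrec.snd (primrec_two_pow.comp
    (Primrec.nat_sub.comp (Primrec.fst.comp Primrec.fst) (Primrec.list_length.comp Primrec.snd))))

/-- The value of the bit `b` for which the programs with this value have the smaller weight. -/
def lighterBit (L : ℕ) (b : List Bool → Bool) (R : List (List Bool)) : Bool :=
  decide (scaledWeight L (R.filter b) ≤ scaledWeight L (R.filter fun σ => !b σ))

/-- The part of `R` on which the bit `b` has the value `lighterBit L b R`. -/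
def lighterHalf (L : ℕ) (b : List Bool → Bool) (R : List (List Bool)) : List (List Bool) :=
  R.filter fun σ => b σ == lighterBit L b R

theorem scaledWeight_filter_add (L : ℕ) (b : List Bool → Bool) (R : List (List Bool)) :
    scaledWeight L (R.filter b) + scaledWeight L (R.filter fun σ => !b σ) = scaledWeight L R := by
  induction R with
  | nil => rfl
  | cons σ R ih =>
    unfold scaledWeight at ih ⊢
    cases h : b σ <;> simp [h, ← ih] <;> ring

theorem two_mul_scaledWeight_lighterHalf_le (L : ℕ) (b : List Bool → Bool)
    (R : List (List Bool)) : 2 * scaledWeight L (lighterHalf L b R) ≤ scaledWeight L R := by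
  have hadd := scaledWeight_filter_add L b R
  by_cases h : scaledWeight L (R.filter b) ≤ scaledWeight L (R.filter fun σ => !b σ)
  · have : lighterHalf L b R = R.filter b := by simp [lighterHalf, lighterBit, h]
    rw [this]
    omega
  · have : lighterHalf L b R = R.filter fun σ => !b σ := by simp [lighterHalf, lighterBit, h]
    rw [this]
    omega

theorem scaledWeight_eq {L : ℕ} {R : List (List Bool)} (hR : R.Nodup)
    (hL : ∀ σ ∈ R, σ.length ≤ L) :
    (scaledWeight L R : ℝ) = 2 ^ L * ∑ σ ∈ R.toFinset, (1 / 2 : ℝ) ^ σ.length := by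
  rw [scaledWeight, ← List.sum_toFinset _ hR, Finset.mul_sum]
  push_cast
  refine Finset.sum_congr rfl fun σ hσ => ?_
  rw [pow_sub₀ _ two_ne_zero (hL σ (List.mem_toFinset.1 hσ))]
  simp

/-! ### The controlled indices and the surviving programs -/

/-- The `i`-th index whose membership in the index set is controlled for the sake of block `j`. -/
def controlIndex (c : Code) (j i : ℕ) : ℕ :=
  Encodable.encode (c.curry (Nat.pair j i))

/-- Block `j` consists of the strings whose length is at least `blockStart c j` and less than
`blockStart c (j + 1)`. The sum is a convenient way to exceed all controlled indices of block `j`,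
whose codes `Nat.pair j i` are less than `Nat.pair j j`. -/
def blockStart (c : Code) (j : ℕ) : ℕ :=
  ((List.range (Nat.pair j j)).map fun m => Encodable.encode (c.curry m) + 1).sum

theorem controlIndex_lt (c : Code) {i j : ℕ} (h : i < j) : controlIndex c j i < blockStart c j :=
  Nat.lt_of_succ_le <| List.le_sum_of_mem <| List.mem_map.2
    ⟨Nat.pair j i, List.mem_range.2 (Nat.pair_lt_pair_right j h), rfl⟩

theorem blockStart_mono (c : Code) : Monotone (blockStart c) := by
  intro i j h
  refine List.Sublist.sum_le_sum (List.Sublist.map _ (List.range_sublist.2 ?_)) (by simp)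
  rcases h.lt_or_eq with h | rfl
  · exact ((Nat.pair_lt_pair_left i h).trans (Nat.pair_lt_pair_right j h)).le
  · exact le_rfl

theorem le_blockStart (c : Code) (j : ℕ) : j ≤ blockStart c j := by
  have := List.length_le_sum_of_one_le ((List.range (Nat.pair j j)).map fun m =>
    Encodable.encode (c.curry m) + 1) (by simp)
  rw [List.length_map, List.length_range] at this
  exact (Nat.left_le_pair j j).trans this

/-- Every length at least `blockStart c j₀` belongs to a block `j ≥ j₀`. -/
theorem exists_block (c : Code) {j₀ n : ℕ} (h : blockStart c j₀ ≤ n) :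
    ∃ j ≥ j₀, blockStart c j ≤ n ∧ n < blockStart c (j + 1) := by
  have hex : ∃ j, n < blockStart c j := ⟨n + 1, (Nat.lt_succ_self n).trans_le (le_blockStart c _)⟩
  have hspec := Nat.find_spec hex
  have hpos : j₀ < Nat.find hex := by
    by_contra hle
    exact absurd ((blockStart_mono c (not_lt.1 hle)).trans h) (not_le.2 hspec)
  obtain ⟨j, hj⟩ : ∃ j, Nat.find hex = j + 1 := ⟨Nat.find hex - 1, by omega⟩
  refine ⟨j, by omega, not_lt.1 (Nat.find_min hex (by omega)), hj ▸ hspec⟩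

theorem primrec_controlIndex : Primrec fun p : (Code × ℕ) × ℕ => controlIndex p.1.1 p.1.2 p.2 :=
  Primrec.encode.comp (Code.primrec₂_curry.comp (Primrec.fst.comp Primrec.fst)
    (Primrec₂.natPair.comp (Primrec.snd.comp Primrec.fst) Primrec.snd))

theorem primrec_blockStart : Primrec₂ blockStart :=
  primrec_list_sum.comp (Primrec.list_map
    (Primrec.list_range.comp (Primrec₂.natPair.comp Primrec.snd Primrec.snd))
    (Primrec.succ.comp (Primrec.encode.comp
      (Code.primrec₂_curry.comp (Primrec.fst.comp Primrec.fst) Primrec.snd))))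

-- Unfolding these would let unification compute with codes of programs.
attribute [irreducible] controlIndex blockStart

/-- A bound on the length of the programs that matter for outputs of length at most `h`. It is at
least `Encodable.encode τ + D` for each such output `τ`; with a suitable `D`, a program of this
length exceeds `K U τ` by any given constant. -/
def programBound (D h : ℕ) : ℕ :=
  ((stringsLE h).map Encodable.encode).sum + D

theorem encode_add_le_programBound (D : ℕ) {h : ℕ} {τ : List Bool} (hτ : τ.length ≤ h) :
    Encodable.encode τ + D ≤ programBound D h :=
  Nat.add_le_add_right (List.le_sum_of_mem (List.mem_map_of_mem (mem_stringsLE.2 hτ))) D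

/-- The programs, up to the length bound, that produce a string of block `j` within `S` steps. -/
def candidates {k : ℕ} (U : TuringMachine k) (D : ℕ) (c : Code) (j S : ℕ) : List (List Bool) :=
  (stringsLE (programBound D (blockStart c (j + 1)))).filter fun σ =>
    Option.casesOn (outputWithin U σ S) false fun τ =>
      decide (blockStart c j ≤ τ.length) && decide (τ.length < blockStart c (j + 1))

/-- The bit with index `e` of the output of `σ` within `S` steps (`false` if there is none). -/
def outputBit {k : ℕ} (U : TuringMachine k) (S e : ℕ) (σ : List Bool) : Bool :=
  ((outputWithin U σ S).getD []).getD e false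

/-- The candidates of block `j` that remain after the weight has been halved at the first `i`
controlled indices. -/
def survivors {k : ℕ} (U : TuringMachine k) (D : ℕ) (c : Code) (j S i : ℕ) : List (List Bool) :=
  i.rec (candidates U D c j S) fun i R =>
    lighterHalf (programBound D (blockStart c (j + 1))) (outputBit U S (controlIndex c j i)) R

/-- The bit that the `i`-th controlled index of block `j` is given. -/
def controlBit {k : ℕ} (U : TuringMachine k) (D : ℕ) (c : Code) (j S i : ℕ) : Bool :=
  lighterBit (programBound D (blockStart c (j + 1))) (outputBit U S (controlIndex c j i))
    (survivors U D c j S i)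

theorem survivors_succ {k : ℕ} (U : TuringMachine k) (D : ℕ) (c : Code) (j S i : ℕ) :
    survivors U D c j S (i + 1) = (survivors U D c j S i).filter fun σ =>
      outputBit U S (controlIndex c j i) σ == controlBit U D c j S i := rfl

theorem mem_candidates {k : ℕ} {U : TuringMachine k} {D : ℕ} {c : Code} {j S : ℕ}
    {σ : List Bool} : σ ∈ candidates U D c j S ↔
      σ.length ≤ programBound D (blockStart c (j + 1)) ∧ ∃ τ, outputWithin U σ S = some τ ∧
        blockStart c j ≤ τ.length ∧ τ.length < blockStart c (j + 1) := by
  rw [candidates, List.mem_filter, mem_stringsLE]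
  cases outputWithin U σ S <;> simp

theorem survivors_sublist {k : ℕ} (U : TuringMachine k) (D : ℕ) (c : Code) (j S i : ℕ) :
    (survivors U D c j S i).Sublist (candidates U D c j S) := by
  induction i with
  | zero => exact List.Sublist.refl _
  | succ i ih => rw [survivors_succ]; exact List.filter_sublist.trans ih

/-- A candidate survives if its output agrees with the control bits, as the initial segments of the
index set do. -/
theorem mem_survivors {k : ℕ} {U : TuringMachine k} {D : ℕ} {c : Code} {j S : ℕ} {σ τ : List Bool}
    (hσ : σ ∈ candidates U D c j S) (hτ : outputWithin U σ S = some τ) (i : ℕ)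
    (h : ∀ i' < i, τ.getD (controlIndex c j i') false = controlBit U D c j S i') :
    σ ∈ survivors U D c j S i := by
  induction i with
  | zero => exact hσ
  | succ i ih =>
    rw [survivors_succ, List.mem_filter]
    refine ⟨ih fun i' hi' => h i' (by omega), ?_⟩
    rw [beq_iff_eq, ← h i (Nat.lt_succ_self i), outputBit, hτ, Option.getD_some]

theorem two_pow_mul_scaledWeight_survivors_le {k : ℕ} (U : TuringMachine k) (D : ℕ) (c : Code)
    (j S i : ℕ) :
    2 ^ i * scaledWeight (programBound D (blockStart c (j + 1))) (survivors U D c j S i) ≤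
      scaledWeight (programBound D (blockStart c (j + 1))) (candidates U D c j S) := by
  induction i with
  | zero => simp [survivors]
  | succ i ih =>
    refine le_trans ?_ ih
    rw [pow_succ, mul_assoc]
    exact Nat.mul_le_mul_left _ (two_mul_scaledWeight_lighterHalf_le _ _ _)

theorem two_pow_mul_sum_survivors_le {k : ℕ} (U : TuringMachine k) (D : ℕ) (c : Code)
    (j S i : ℕ) :
    2 ^ i * ∑ σ ∈ (survivors U D c j S i).toFinset, (1 / 2 : ℝ) ^ σ.length ≤
      ∑ σ ∈ (candidates U D c j S).toFinset, (1 / 2 : ℝ) ^ σ.length := by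
  have hnodup : (candidates U D c j S).Nodup := (nodup_stringsLE _).filter _
  have hsub := survivors_sublist U D c j S i
  have hlen : ∀ σ ∈ candidates U D c j S, σ.length ≤ programBound D (blockStart c (j + 1)) :=
    fun σ hσ => (mem_candidates.1 hσ).1
  have h := two_pow_mul_scaledWeight_survivors_le U D c j S i
  rw [← Nat.cast_le (α := ℝ), Nat.cast_mul, Nat.cast_pow, Nat.cast_ofNat,
    scaledWeight_eq hnodup hlen, scaledWeight_eq (hnodup.sublist hsub)
    fun σ hσ => hlen σ (hsub.subset hσ), mul_left_comm] at h
  exact le_of_mul_le_mul_left h (by positivity)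

theorem primrec_blockEnd : Primrec fun p : Code × ℕ => blockStart p.1 (p.2 + 1) :=
  primrec_blockStart.comp Primrec.fst (Primrec.succ.comp Primrec.snd)

theorem primrec_programBound (D : ℕ) : Primrec (programBound D) :=
  Primrec.nat_add.comp (primrec_list_sum.comp (Primrec.list_map primrec_stringsLE
    (Primrec.encode.comp Primrec.snd))) (Primrec.const D)

theorem primrec_candidates {k : ℕ} (U : TuringMachine k) (D : ℕ) :
    Primrec fun p : (Code × ℕ) × ℕ => candidates U D p.1.1 p.1.2 p.2 := by
  have hend : Primrec fun p : (Code × ℕ) × ℕ => blockStart p.1.1 (p.1.2 + 1) :=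
    primrec_blockEnd.comp Primrec.fst
  have hstart : Primrec fun p : (Code × ℕ) × ℕ => blockStart p.1.1 p.1.2 :=
    primrec_blockStart.comp (Primrec.fst.comp Primrec.fst) (Primrec.snd.comp Primrec.fst)
  have hlen : Primrec fun q : (((Code × ℕ) × ℕ) × List Bool) × List Bool => q.2.length :=
    Primrec.list_length.comp Primrec.snd
  refine primrec_filter (primrec_stringsLE.comp ((primrec_programBound D).comp hend)) ?_
  refine Primrec.option_casesOn ((primrec_outputWithin U).comp Primrec.snd
    (Primrec.snd.comp Primrec.fst)) (Primrec.const false) ?_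
  exact Primrec.and.comp
    (Primrec.nat_le.decide.comp (hstart.comp (Primrec.fst.comp Primrec.fst)) hlen)
    (Primrec.nat_lt.decide.comp hlen (hend.comp (Primrec.fst.comp Primrec.fst)))

theorem primrec_outputBit {k : ℕ} (U : TuringMachine k) {α : Type*} [Primcodable α] {S e : α → ℕ}
    (hS : Primrec S) (he : Primrec e) : Primrec₂ fun a σ => outputBit U (S a) (e a) σ :=
  (Primrec.list_getD false).comp (Primrec.option_getD.comp
    ((primrec_outputWithin U).comp Primrec.snd (hS.comp Primrec.fst)) (Primrec.const []))
    (he.comp Primrec.fst)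

theorem primrec_lighterBit {α : Type*} [Primcodable α] {L : α → ℕ} {b : α → List Bool → Bool}
    {R : α → List (List Bool)} (hL : Primrec L) (hb : Primrec₂ b) (hR : Primrec R) :
    Primrec fun a => lighterBit (L a) (b a) (R a) :=
  Primrec.nat_le.decide.comp (primrec_scaledWeight.comp hL (primrec_filter hR hb))
    (primrec_scaledWeight.comp hL (primrec_filter hR (Primrec.not.comp hb)))

theorem primrec_lighterHalf {α : Type*} [Primcodable α] {L : α → ℕ} {b : α → List Bool → Bool}
    {R : α → List (List Bool)} (hL : Primrec L) (hb : Primrec₂ b) (hR : Primrec R) :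
    Primrec fun a => lighterHalf (L a) (b a) (R a) :=
  primrec_filter hR (Primrec.beq.comp hb ((primrec_lighterBit hL hb hR).comp Primrec.fst))

theorem primrec_survivors {k : ℕ} (U : TuringMachine k) (D : ℕ) :
    Primrec fun p : ((Code × ℕ) × ℕ) × ℕ => survivors U D p.1.1.1 p.1.1.2 p.1.2 p.2 := by
  have hL : Primrec fun q : (((Code × ℕ) × ℕ) × ℕ) × ℕ × List (List Bool) =>
      programBound D (blockStart q.1.1.1.1 (q.1.1.1.2 + 1)) :=
    (primrec_programBound D).comp (primrec_blockEnd.comp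
      (Primrec.fst.comp (Primrec.fst.comp Primrec.fst)))
  have hindex : Primrec fun q : (((Code × ℕ) × ℕ) × ℕ) × ℕ × List (List Bool) =>
      controlIndex q.1.1.1.1 q.1.1.1.2 q.2.1 :=
    primrec_controlIndex.comp ((Primrec.fst.comp (Primrec.fst.comp Primrec.fst)).pair
      (Primrec.fst.comp Primrec.snd))
  have hstep := primrec_lighterHalf hL
    (primrec_outputBit U (Primrec.snd.comp (Primrec.fst.comp Primrec.fst)) hindex)
    (Primrec.snd.comp Primrec.snd)
  have hrec := Primrec.nat_rec' Primrec.snd ((primrec_candidates U D).comp Primrec.fst) hstep.to₂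
  exact hrec.of_eq fun p => rfl

theorem primrec_controlBit {k : ℕ} (U : TuringMachine k) (D : ℕ) :
    Primrec fun p : ((Code × ℕ) × ℕ) × ℕ => controlBit U D p.1.1.1 p.1.1.2 p.1.2 p.2 := by
  have hL : Primrec fun p : ((Code × ℕ) × ℕ) × ℕ =>
      programBound D (blockStart p.1.1.1 (p.1.1.2 + 1)) :=
    (primrec_programBound D).comp (primrec_blockEnd.comp (Primrec.fst.comp Primrec.fst))
  have hindex : Primrec fun p : ((Code × ℕ) × ℕ) × ℕ => controlIndex p.1.1.1 p.1.1.2 p.2 :=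
    primrec_controlIndex.comp ((Primrec.fst.comp Primrec.fst).pair Primrec.snd)
  have hbit := primrec_lighterBit hL
    (primrec_outputBit U (Primrec.snd.comp Primrec.fst) hindex) (primrec_survivors U D)
  exact hbit.of_eq fun p => rfl

attribute [irreducible] survivors controlBit

/-! ### Shorter programs for the survivors -/

/-- The number of steps allowed in block `j` for the time bound `t`. -/
def blockTime (t : ℕ → ℕ) (c : Code) (j : ℕ) : ℕ :=
  t (blockStart c (j + 1))

theorem computable_blockTime {t : ℕ → ℕ} (ht : Computable t) : Computable₂ (blockTime t) :=
  ht.comp primrec_blockEnd.to_comp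

theorem PrefixFree.sum_candidates_le_one {k : ℕ} {U : TuringMachine k}
    (hU : PrefixFree {σ | ∃ τ, Computes U σ τ}) (D : ℕ) (c : Code) (S : ℕ → ℕ) (s : Finset ℕ) :
    ∑ j ∈ s, ∑ σ ∈ (candidates U D c j (S j)).toFinset, (1 / 2 : ℝ) ^ σ.length ≤ 1 := by
  have hcand : ∀ j σ, σ ∈ (candidates U D c j (S j)).toFinset → ∃ τ, Computes U σ τ ∧
      blockStart c j ≤ τ.length ∧ τ.length < blockStart c (j + 1) := by
    intro j σ hσ
    obtain ⟨-, τ, hτ, hlen⟩ := mem_candidates.1 (List.mem_toFinset.1 hσ)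
    exact ⟨τ, ((outputWithin_eq_some U σ τ _).1 hτ).computes, hlen⟩
  rw [← Finset.sum_biUnion]
  · refine (hU.mono ?_).sum_le_one
    intro σ hσ
    obtain ⟨j, -, hj⟩ := Finset.mem_biUnion.1 (Finset.mem_coe.1 hσ)
    obtain ⟨τ, hτ, -⟩ := hcand j σ hj
    exact ⟨τ, hτ⟩
  · intro j _ j' _ hne
    refine Finset.disjoint_left.2 fun σ hσ hσ' => hne ?_
    obtain ⟨τ, hτ, h₁, h₂⟩ := hcand j σ hσ
    obtain ⟨τ', hτ', h₁', h₂'⟩ := hcand j' σ hσ'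
    obtain rfl := hτ.unique hτ'
    have hle := (blockStart_mono c).reflect_lt (h₁.trans_lt h₂')
    have hle' := (blockStart_mono c).reflect_lt (h₁'.trans_lt h₂)
    omega

/-- The `j` halvings leave weight at most `2 ^ (-j)`, so no survivor is shorter than `j`. -/
theorem PrefixFree.le_length_of_mem_survivors {k : ℕ} {U : TuringMachine k}
    (hU : PrefixFree {σ | ∃ τ, Computes U σ τ}) {D : ℕ} {c : Code} {j S : ℕ} {σ : List Bool}
    (hσ : σ ∈ survivors U D c j S j) : j ≤ σ.length := by
  have h₁ := two_pow_mul_sum_survivors_le U D c j S j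
  have h₂ : ∑ σ ∈ (candidates U D c j S).toFinset, (1 / 2 : ℝ) ^ σ.length ≤ 1 := by
    simpa using hU.sum_candidates_le_one D c (fun _ => S) {j}
  have h₃ : (1 / 2 : ℝ) ^ σ.length ≤
      ∑ σ ∈ (survivors U D c j S j).toFinset, (1 / 2 : ℝ) ^ σ.length :=
    Finset.single_le_sum (f := fun σ : List Bool => (1 / 2 : ℝ) ^ σ.length)
      (fun _ _ => by positivity) (List.mem_toFinset.2 hσ)
  have h₄ : (2 : ℝ) ^ j * (1 / 2) ^ σ.length ≤ 1 :=
    (mul_le_mul_of_nonneg_left h₃ (by positivity)).trans (h₁.trans h₂)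
  rw [one_div, inv_pow, ← div_eq_mul_inv, div_le_one (by positivity)] at h₄
  exact (pow_le_pow_iff_right₀ one_lt_two).1 h₄

/-- The request for a program that is shorter than the survivor `p.2` of block `p.1` by `p.1` bits
and has the same output. -/
def blockRequest {k : ℕ} (U : TuringMachine k) (D : ℕ) (c : Code) (t : ℕ → ℕ)
    (p : ℕ × List Bool) : Option (ℕ × List Bool) :=
  (outputWithin U p.2 (blockTime t c p.1)).bind fun τ =>
    cond (decide (p.2 ∈ survivors U D c p.1 (blockTime t c p.1) p.1))
      (some (p.2.length - p.1, τ)) none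

theorem computable_blockRequest {k : ℕ} (U : TuringMachine k) (D : ℕ) (c : Code) {t : ℕ → ℕ}
    (ht : Computable t) : Computable (blockRequest U D c t) := by
  have htime : Computable fun p : ℕ × List Bool => blockTime t c p.1 :=
    (computable_blockTime ht).comp (Computable.const c) Computable.fst
  have hsurv : Computable fun p : ℕ × List Bool =>
      survivors U D c p.1 (blockTime t c p.1) p.1 :=
    (primrec_survivors U D).to_comp.comp
      ((((Computable.const c).pair Computable.fst).pair htime).pair Computable.fst)
  have hmem : Computable fun p : ℕ × List Bool =>
      decide (p.2 ∈ survivors U D c p.1 (blockTime t c p.1) p.1) :=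
    primrec_decide_mem.to_comp.comp Computable.snd hsurv
  have hlen : Computable fun p : ℕ × List Bool => p.2.length - p.1 :=
    (Primrec.nat_sub.comp (Primrec.list_length.comp Primrec.snd) Primrec.fst).to_comp
  have hout : Computable fun p : ℕ × List Bool => outputWithin U p.2 (blockTime t c p.1) :=
    (primrec_outputWithin U).to_comp.comp Computable.snd htime
  have hbind := Computable.option_bind hout
    (Computable.cond (hmem.comp Computable.fst)
      (Computable.option_some.comp ((hlen.comp Computable.fst).pair Computable.snd))
      (Computable.const none)).to₂
  exact hbind.of_eq fun p => rfl

theorem requestWeight_blockRequest_le {k : ℕ} {U : TuringMachine k}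
    (hU : PrefixFree {σ | ∃ τ, Computes U σ τ}) (D : ℕ) (c : Code) (t : ℕ → ℕ)
    (p : ℕ × List Bool) : requestWeight (blockRequest U D c t p) ≤
      if p.2 ∈ survivors U D c p.1 (blockTime t c p.1) p.1 then
        2 ^ p.1 * (1 / 2 : ℝ) ^ p.2.length else 0 := by
  unfold blockRequest
  by_cases hp : p.2 ∈ survivors U D c p.1 (blockTime t c p.1) p.1
  · have hle := hU.le_length_of_mem_survivors hp
    cases outputWithin U p.2 (blockTime t c p.1) with
    | none => simp [hp, requestWeight]
    | some τ =>
      simp only [hp, Option.bind_some, decide_true, cond_true, requestWeight, Option.elim_some,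
        if_true]
      rw [pow_sub₀ _ (by norm_num) hle, mul_comm]
      simp
  · cases outputWithin U p.2 (blockTime t c p.1) <;> simp [hp, requestWeight]

theorem PrefixFree.sum_blockRequest_le_one {k : ℕ} {U : TuringMachine k}
    (hU : PrefixFree {σ | ∃ τ, Computes U σ τ}) (D : ℕ) (c : Code) (t : ℕ → ℕ)
    (F : Finset (ℕ × List Bool)) :
    ∑ p ∈ F, requestWeight (blockRequest U D c t p) ≤ 1 := by
  set T : ℕ → Finset (List Bool) := fun j =>
    (survivors U D c j (blockTime t c j) j).toFinset with hT
  set s := F.image Prod.fst with hs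
  calc ∑ p ∈ F, requestWeight (blockRequest U D c t p)
      ≤ ∑ p ∈ F, if p.2 ∈ T p.1 then 2 ^ p.1 * (1 / 2 : ℝ) ^ p.2.length else 0 := by
        refine Finset.sum_le_sum fun p _ => ?_
        simpa [hT] using requestWeight_blockRequest_le hU D c t p
    _ = ∑ p ∈ F with p.2 ∈ T p.1, 2 ^ p.1 * (1 / 2 : ℝ) ^ p.2.length :=
        (Finset.sum_filter _ _).symm
    _ ≤ ∑ p ∈ s ×ˢ s.biUnion T with p.2 ∈ T p.1, 2 ^ p.1 * (1 / 2 : ℝ) ^ p.2.length := by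
        refine Finset.sum_le_sum_of_subset_of_nonneg (fun p hp => ?_) fun _ _ _ => by positivity
        obtain ⟨hpF, hpT⟩ := Finset.mem_filter.1 hp
        have hps : p.1 ∈ s := Finset.mem_image_of_mem _ hpF
        exact Finset.mem_filter.2
          ⟨Finset.mem_product.2 ⟨hps, Finset.mem_biUnion.2 ⟨p.1, hps, hpT⟩⟩, hpT⟩
    _ = ∑ j ∈ s, ∑ σ ∈ T j, 2 ^ j * (1 / 2 : ℝ) ^ σ.length := by
        refine Finset.sum_finset_product _ _ _ fun p => ?_
        rw [Finset.mem_filter, Finset.mem_product, Finset.mem_biUnion]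
        exact ⟨fun h => ⟨h.1.1, h.2⟩, fun h => ⟨⟨h.1, p.1, h.1, h.2⟩, h.2⟩⟩
    _ ≤ ∑ j ∈ s, ∑ σ ∈ (candidates U D c j (blockTime t c j)).toFinset,
          (1 / 2 : ℝ) ^ σ.length := by
        refine Finset.sum_le_sum fun j _ => ?_
        rw [← Finset.mul_sum]
        exact two_pow_mul_sum_survivors_le U D c j _ j
    _ ≤ 1 := hU.sum_candidates_le_one D c (blockTime t c) s

/-! ### Control by the recursion theorem -/

/-- There is a code `c` whose controlled indices compute, according to the control bits that are
themselves determined from `c`, one of two given functions. -/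
theorem exists_controlled_code {k : ℕ} (U : TuringMachine k) (D : ℕ) {t : ℕ → ℕ}
    (ht : Computable t) (a b : ℕ) :
    ∃ c : Code, ∀ j i, phi (controlIndex c j i) =
      cond (controlBit U D c j (blockTime t c j) i) (phi a) (phi b) := by
  let G : Code → ℕ →. ℕ := fun c x =>
    cond (controlBit U D c x.unpair.1.unpair.1 (blockTime t c x.unpair.1.unpair.1)
      x.unpair.1.unpair.2) (phi a x.unpair.2) (phi b x.unpair.2)
  have hphi : ∀ e, Partrec fun p : Code × ℕ => phi e p.2.unpair.2 := fun e =>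
    Code.eval_part.comp (Computable.const _)
      (Computable.snd.comp (Computable.unpair.comp Computable.snd))
  have hji : Computable fun p : Code × ℕ => p.2.unpair.1.unpair :=
    Computable.unpair.comp (Computable.fst.comp (Computable.unpair.comp Computable.snd))
  have hbit : Computable fun p : Code × ℕ => controlBit U D p.1 p.2.unpair.1.unpair.1
      (blockTime t p.1 p.2.unpair.1.unpair.1) p.2.unpair.1.unpair.2 :=
    (primrec_controlBit U D).to_comp.comp
      (((Computable.fst.pair (Computable.fst.comp hji)).pair
        ((computable_blockTime ht).comp Computable.fst (Computable.fst.comp hji))).pair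
        (Computable.snd.comp hji))
  have hG : Partrec₂ G := Partrec.cond hbit (hphi a) (hphi b)
  obtain ⟨c, hc⟩ := Code.fixed_point₂ hG
  refine ⟨c, fun j i => ?_⟩
  funext y
  have hy : phi (controlIndex c j i) y = G c (Nat.pair (Nat.pair j i) y) := by
    rw [← hc, ← Code.eval_curry, phi, controlIndex, Denumerable.ofNat_encode]
  rw [hy]
  simp only [G, Nat.unpair_pair]
  cases controlBit U D c j (blockTime t c j) i <;> rfl

/-! ### Index sets are strongly deep -/

theorem length_initSeg (X : ℕ → Bool) (n : ℕ) : (initSeg X n).length = n := by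
  simp [initSeg]

theorem initSeg_getD (X : ℕ → Bool) {n e : ℕ} (h : e < n) : (initSeg X n).getD e false = X e := by
  simp [initSeg, List.getD, h]

theorem K_le {k : ℕ} {U : TuringMachine k} {σ τ : List Bool} (h : Computes U σ τ) :
    K U τ ≤ σ.length :=
  iInf₂_le σ h

theorem IsIndexSet.stronglyDeep {k : ℕ} {U : TuringMachine k} (hU : IsUniversalPrefixFree U)
    {C : Set ℕ} (hC : IsIndexSet C) {a b : ℕ} (ha : a ∈ C) (hb : b ∉ C) :
    StronglyDeep U (charSeq C) := by
  intro t ht hmono r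
  obtain ⟨d₁, hd₁⟩ := hU.exists_program_le_encode
  obtain ⟨c, hc⟩ := exists_controlled_code U (d₁ + r) ht a b
  have hbit : ∀ j i, charSeq C (controlIndex c j i) =
      controlBit U (d₁ + r) c j (blockTime t c j) i := by
    intro j i
    have h := hc j i
    cases hv : controlBit U (d₁ + r) c j (blockTime t c j) i
    · rw [hv, cond_false] at h
      simpa [charSeq] using mt (hC _ _ h).1 hb
    · rw [hv, cond_true] at h
      simpa [charSeq] using (hC _ _ h).2 ha
  obtain ⟨d₂, hd₂⟩ := hU.exists_program_of_requests
    (computable_blockRequest U (d₁ + r) c ht) (hU.1.sum_blockRequest_le_one (d₁ + r) c t)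
  filter_upwards [Filter.eventually_ge_atTop (blockStart c (d₂ + r))] with n hn
  obtain ⟨j, hj, hlow, hupp⟩ := exists_block c hn
  refine le_iInf₂ fun σ hσ => ?_
  set τ := initSeg (charSeq C) n with hτ
  have hlen : τ.length = n := length_initSeg _ n
  rw [hlen] at hσ
  -- It suffices to find a program for `τ` that is shorter than `σ` by `r` bits.
  suffices h : ∃ ρ, ρ.length + r ≤ σ.length ∧ Computes U ρ τ by
    obtain ⟨ρ, hρ, hcomp⟩ := h
    calc K U τ + r ≤ ρ.length + r := by gcongr; exact K_le hcomp
      _ ≤ σ.length := by exact_mod_cast hρ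
  by_cases hbound : σ.length ≤ programBound (d₁ + r) (blockStart c (j + 1))
  · have hout : outputWithin U σ (blockTime t c j) = some τ :=
      (outputWithin_eq_some U σ τ _).2 (hσ.mono (hmono hupp.le))
    have hcand : σ ∈ candidates U (d₁ + r) c j (blockTime t c j) :=
      mem_candidates.2 ⟨hbound, τ, hout, by rwa [hlen], by rwa [hlen]⟩
    have hsurv : σ ∈ survivors U (d₁ + r) c j (blockTime t c j) j :=
      mem_survivors hcand hout j fun i hi => by
        rw [← hbit, hτ, initSeg_getD _ ((controlIndex_lt c hi).trans_le hlow)]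
    have hjσ := hU.1.le_length_of_mem_survivors hsurv
    obtain ⟨ρ, hρ, hcomp⟩ := hd₂ (j, σ) (σ.length - j) τ (by simp [blockRequest, hout, hsurv])
    exact ⟨ρ, by omega, hcomp⟩
  · obtain ⟨ρ, hρ, hcomp⟩ := hd₁ τ
    have := encode_add_le_programBound (d₁ + r) (τ := τ) (h := blockStart c (j + 1))
      (by rw [hlen]; exact hupp.le)
    exact ⟨ρ, by omega, hcomp⟩

end StrongDepth

theorem mainTheorem12 {k : ℕ} (U : StrongDepth.TuringMachine k)
    (hU : StrongDepth.IsUniversalPrefixFree U)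
    (C : Set ℕ) (hC : StrongDepth.IsIndexSet C) :
    (¬ StrongDepth.StronglyDeep U (StrongDepth.charSeq C) → C = ∅ ∨ C = Set.univ) ∧
    (C ≠ ∅ → C ≠ Set.univ → StrongDepth.StronglyDeep U (StrongDepth.charSeq C)) := by
  have hdeep : C ≠ ∅ → C ≠ Set.univ → StrongDepth.StronglyDeep U (StrongDepth.charSeq C) := by
    intro hne huniv
    obtain ⟨a, ha⟩ := Set.nonempty_iff_ne_empty.2 hne
    obtain ⟨b, hb⟩ := (Set.ne_univ_iff_exists_notMem C).1 huniv
    exact hC.stronglyDeep hU ha hb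
  refine ⟨fun h => ?_, hdeep⟩
  by_contra! hcontra
  exact h (hdeep hcontra.1.ne_empty hcontra.2)
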